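/- Let $A$ be an associative ring with unit. An $A$-coring $\mathfrak C$ is an $A$-bimodule with $A$-bilinear maps $\Delta:\mathfrak C\to\mathfrak C\otimes_A\mathfrak C$ (coassociative) and $\varepsilon:\mathfrak C\to A$ (a counit for $\Delta$). A right $\mathfrak C$-comodule is a right $A$-module $M$ with a right $A$-linear map $\rho_M:M\to M\otimes_A\mathfrak C$, $\rho_M(m)=m_{[0]}\otimes_A m_{[1]}$ (summation understood), such that $(\rho_M\otimes_A\mathfrak C)\circ\rho_M=(M\otimes_A\Delta)\circ\rho_M$ and $(M\otimes_A\varepsilon)\circ\rho_M=\mathrm{id}_M$. A right $A$-linear map $f:M\to N$ between comodules is colinear if $\rho_N\circ f=(f\otimes_A\mathfrak C)\circ\rho_M$; $\mathrm{Hom}^{\mathfrak C}(M,N)$ denotes the group of colinear maps. A comodule $N$ is $(\mathfrak C,A)$-injective if for every colinear map $i:K\to L$ that has a right $A$-linear left inverse, every colinear map $K\to N$ factors through $i$ by a colinear map $L\to N$. A ring $R$, not necessarily with unit, is firm if the multiplication map $R\otimes_R R\to R$ is an isomorphism, and a left $R$-module $\Sigma$ is firm if $R\otimes_R\Sigma\to\Sigma$,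 $r\otimes u\mapsto ru$, is an isomorphism. **Theorem.** Let $R$ be a firm ring, $\mathfrak C$ an $A$-coring, and $\Sigma$ an $R$-$A$-bimodule that is firm as a left $R$-module and carries a right $\mathfrak C$-comodule structure with left $R$-linear coaction $\rho_\Sigma$. Let $R$ act from the right on $\mathrm{Hom}_A(\Sigma,M)$ and on $\mathrm{Hom}^{\mathfrak C}(\Sigma,N)$ by $(fr)(u)=f(ru)$. The following are equivalent. 1. $\Sigma$ is an $R$-$\mathfrak C$ comonadic-Galois comodule, i.e. for every right $A$-module $M$ the map $$\mathrm{can}_M:\mathrm{Hom}_A(\Sigma,M)\otimes_R\Sigma\to M\otimes_A\mathfrak C,\qquad \mathrm{can}_M(f\otimes_R u)=f(u_{[0]})\otimes_A u_{[1]}$$ is an isomorphism. 2. For every $(\mathfrak C,A)$-injective right $\mathfrak C$-comodule $N$ the evaluation map $$\mathrm{ev}_N:\mathrm{Hom}^{\mathfrak C}(\Sigma,N)\otimes_R\Sigma\to N,\qquad \mathrm{ev}_N(f\otimes_R u)=f(u)$$ is an isomorphism. -/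

import Mathlib

open scoped TensorProduct
open MulOpposite

universe u

/-- Module laws for a ring without unit: the action of `R` on the abelian group `M` is additive in
both variables and associative. A left `R`-module is an abelian group with such an action. -/
class IsNonUnitalModule (R M : Type*) [NonUnitalRing R] [AddCommGroup M] [DistribSMul R M] :
    Prop where
  add_smul' : ∀ (r s : R) (m : M), (r + s) • m = r • m + s • m
  mul_smul' : ∀ (r s : R) (m : M), (r * s) • m = r • (s • m)

instance IsNonUnitalModule.ofModule (A M : Type*) [Ring A] [AddCommGroup M] [Module A M] :
    IsNonUnitalModule A M where
  add_smul' := add_smul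
  mul_smul' := mul_smul

instance IsNonUnitalModule.self (R : Type*) [NonUnitalRing R] : IsNonUnitalModule R R where
  add_smul' := add_mul
  mul_smul' := mul_assoc

/-- The subgroup of `M ⊗ N` (tensor product of abelian groups) generated by the elements
`m s ⊗ n - m ⊗ s n`. -/
def balancedRelations (S M N : Type*) [AddCommGroup M] [AddCommGroup N] [SMul Sᵐᵒᵖ M] [SMul S N] :
    AddSubgroup (M ⊗[ℤ] N) :=
  AddSubgroup.closure {x | ∃ (m : M) (s : S) (n : N), x = (op s • m) ⊗ₜ[ℤ] n - m ⊗ₜ[ℤ] (s • n)}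

/-- The tensor product `M ⊗_S N` of a right `S`-module `M` and a left `S`-module `N`, for a not
necessarily commutative, not necessarily unital ring `S`. Right actions of `S` are actions of
`Sᵐᵒᵖ`. -/
def BalTensor (S M N : Type*) [AddCommGroup M] [AddCommGroup N] [SMul Sᵐᵒᵖ M] [SMul S N] :
    Type _ :=
  (M ⊗[ℤ] N) ⧸ balancedRelations S M N

namespace BalTensor

section Basic

variable {S M N P : Type*} [AddCommGroup M] [AddCommGroup N] [AddCommGroup P]
  [SMul Sᵐᵒᵖ M] [SMul S N]

instance : AddCommGroup (BalTensor S M N) :=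
  inferInstanceAs (AddCommGroup ((M ⊗[ℤ] N) ⧸ balancedRelations S M N))

/-- The pure tensor `m ⊗ n` in `M ⊗_S N`. -/
def tmul (S : Type*) {M N : Type*} [AddCommGroup M] [AddCommGroup N] [SMul Sᵐᵒᵖ M] [SMul S N]
    (m : M) (n : N) : BalTensor S M N :=
  QuotientAddGroup.mk' (balancedRelations S M N) (m ⊗ₜ[ℤ] n)

theorem add_tmul (m m' : M) (n : N) : tmul S (m + m') n = tmul S m n + tmul S m' n := by
  simp only [tmul, TensorProduct.add_tmul]
  exact map_add (QuotientAddGroup.mk' (balancedRelations S M N)) _ _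

theorem tmul_add (m : M) (n n' : N) : tmul S m (n + n') = tmul S m n + tmul S m n' := by
  simp only [tmul, TensorProduct.tmul_add]
  exact map_add (QuotientAddGroup.mk' (balancedRelations S M N)) _ _

theorem smul_tmul (s : S) (m : M) (n : N) : tmul S (op s • m) n = tmul S m (s • n) := by
  refine (QuotientAddGroup.eq_iff_sub_mem).2 ?_
  exact AddSubgroup.subset_closure ⟨m, s, n, rfl⟩

/-- The universal property: a biadditive balanced map factors through `M ⊗_S N`. -/
def lift (f : M →+ N →+ P) (hf : ∀ (s : S) (m : M) (n : N), f (op s • m) n = f m (s • n)) :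
    BalTensor S M N →+ P :=
  QuotientAddGroup.lift (balancedRelations S M N)
    (TensorProduct.liftAddHom f (fun k m n => by simp))
    (by
      refine (AddSubgroup.closure_le _).2 ?_
      rintro x ⟨m, s, n, rfl⟩
      simp [hf])

@[simp]
theorem lift_tmul (f : M →+ N →+ P)
    (hf : ∀ (s : S) (m : M) (n : N), f (op s • m) n = f m (s • n)) (m : M) (n : N) :
    lift f hf (tmul S m n) = f m n := rfl

theorem induction {p : BalTensor S M N → Prop} (x : BalTensor S M N) (zero : p 0)
    (pure : ∀ m n, p (tmul S m n)) (add : ∀ x y, p x → p y → p (x + y)) : p x := by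
  obtain ⟨y, rfl⟩ := QuotientAddGroup.mk_surjective x
  induction y using TensorProduct.induction_on with
  | zero => exact zero
  | tmul m n => exact pure m n
  | add a b ha hb => exact add _ _ ha hb

theorem hom_ext {f g : BalTensor S M N →+ P} (h : ∀ m n, f (tmul S m n) = g (tmul S m n)) :
    f = g := by
  ext x
  induction x using induction with
  | zero => simp
  | pure m n => exact h m n
  | add x y hx hy => simp [hx, hy]

/-- The pure tensor as a biadditive map. -/
def mk (S M N : Type*) [AddCommGroup M] [AddCommGroup N] [SMul Sᵐᵒᵖ M] [SMul S N] :
    M →+ N →+ BalTensor S M N :=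
  AddMonoidHom.mk' (fun m => AddMonoidHom.mk' (fun n => tmul S m n) (tmul_add m))
    (fun m m' => by ext n; exact add_tmul m m' n)

@[simp]
theorem mk_apply (m : M) (n : N) : mk S M N m n = tmul S m n := rfl

/-- `f ⊗ g : M ⊗_S N → M' ⊗_S N'` for a right `S`-linear `f` and a left `S`-linear `g`. -/
def map {M' N' : Type*} [AddCommGroup M'] [AddCommGroup N'] [SMul Sᵐᵒᵖ M'] [SMul S N']
    (f : M →+ M') (hf : ∀ (s : S) m, f (op s • m) = op s • f m)
    (g : N →+ N') (hg : ∀ (s : S) n, g (s • n) = s • g n) :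
    BalTensor S M N →+ BalTensor S M' N' :=
  lift (((mk S M' N').comp f).compl₂ g) (fun s m n => by simp [hf, hg, smul_tmul])

@[simp]
theorem map_tmul {M' N' : Type*} [AddCommGroup M'] [AddCommGroup N'] [SMul Sᵐᵒᵖ M'] [SMul S N']
    (f : M →+ M') (hf : ∀ (s : S) m, f (op s • m) = op s • f m)
    (g : N →+ N') (hg : ∀ (s : S) n, g (s • n) = s • g n) (m : M) (n : N) :
    map f hf g hg (tmul S m n) = tmul S (f m) (g n) := rfl

end Basic

section LeftAction

variable {S T M N : Type*} [AddCommGroup M] [AddCommGroup N] [SMul Sᵐᵒᵖ M] [SMul S N]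

/-- A left action on `M` commuting with the right `S`-action gives a left action on `M ⊗_S N`:
`t (m ⊗ n) = t m ⊗ n`. -/
instance leftDistribSMul [DistribSMul T M] [SMulCommClass T Sᵐᵒᵖ M] :
    DistribSMul T (BalTensor S M N) where
  smul t := map (DistribSMul.toAddMonoidHom M t) (fun s m => smul_comm t (op s) m)
    (AddMonoidHom.id N) (fun _ _ => rfl)
  smul_zero _ := map_zero _
  smul_add _ := map_add _

theorem left_smul_tmul [DistribSMul T M] [SMulCommClass T Sᵐᵒᵖ M] (t : T) (m : M) (n : N) :
    t • tmul S m n = tmul S (t • m) n := rfl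

instance leftModule [Ring T] [Module T M] [SMulCommClass T Sᵐᵒᵖ M] :
    Module T (BalTensor S M N) where
  __ := leftDistribSMul
  one_smul x := by
    induction x using induction with
    | zero => exact smul_zero _
    | pure m n => rw [left_smul_tmul, one_smul]
    | add x y hx hy => rw [smul_add, hx, hy]
  mul_smul a b x := by
    induction x using induction with
    | zero => simp only [smul_zero]
    | pure m n => simp only [left_smul_tmul, mul_smul]
    | add x y hx hy => simp only [smul_add, hx, hy]
  add_smul a b x := by
    induction x using induction with
    | zero => simp only [smul_zero, add_zero]
    | pure m n => simp only [left_smul_tmul, add_smul, add_tmul]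
    | add x y hx hy => simp only [smul_add, hx, hy]; abel
  zero_smul x := by
    induction x using induction with
    | zero => exact smul_zero _
    | pure m n => rw [left_smul_tmul, zero_smul]; exact map_zero ((mk S M N).flip n)
    | add x y hx hy => rw [smul_add, hx, hy, add_zero]

end LeftAction

section RightAction

variable {S T M N : Type*} [AddCommGroup M] [AddCommGroup N] [SMul Sᵐᵒᵖ M] [SMul S N]

/-- A right action on `N` commuting with the left `S`-action gives a right action on `M ⊗_S N`:
`(m ⊗ n) t = m ⊗ n t`. -/
instance rightDistribSMul [DistribSMul Tᵐᵒᵖ N] [SMulCommClass S Tᵐᵒᵖ N] :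
    DistribSMul Tᵐᵒᵖ (BalTensor S M N) where
  smul t := map (AddMonoidHom.id M) (fun _ _ => rfl) (DistribSMul.toAddMonoidHom N t)
    (fun s n => (smul_comm s t n).symm)
  smul_zero _ := map_zero _
  smul_add _ := map_add _

theorem right_smul_tmul [DistribSMul Tᵐᵒᵖ N] [SMulCommClass S Tᵐᵒᵖ N] (t : Tᵐᵒᵖ) (m : M)
    (n : N) : t • tmul S m n = tmul S m (t • n) := rfl

instance rightModule [Ring T] [Module Tᵐᵒᵖ N] [SMulCommClass S Tᵐᵒᵖ N] :
    Module Tᵐᵒᵖ (BalTensor S M N) where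
  __ := rightDistribSMul
  one_smul x := by
    induction x using induction with
    | zero => exact smul_zero _
    | pure m n => rw [right_smul_tmul, one_smul]
    | add x y hx hy => rw [smul_add, hx, hy]
  mul_smul a b x := by
    induction x using induction with
    | zero => simp only [smul_zero]
    | pure m n => simp only [right_smul_tmul, mul_smul]
    | add x y hx hy => simp only [smul_add, hx, hy]
  add_smul a b x := by
    induction x using induction with
    | zero => simp only [smul_zero, add_zero]
    | pure m n => simp only [right_smul_tmul, add_smul, tmul_add]
    | add x y hx hy => simp only [smul_add, hx, hy]; abel
  zero_smul x := by
    induction x using induction with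
    | zero => exact smul_zero _
    | pure m n => rw [right_smul_tmul, zero_smul]; exact map_zero (mk S M N m)
    | add x y hx hy => rw [smul_add, hx, hy, add_zero]

end RightAction

section Assoc

variable (A M C D : Type*) [Ring A] [AddCommGroup M] [Module Aᵐᵒᵖ M] [AddCommGroup C] [Module A C]
  [Module Aᵐᵒᵖ C] [SMulCommClass A Aᵐᵒᵖ C] [AddCommGroup D] [Module A D]

/-- The map `(M ⊗_A C) ⊗_A D → M ⊗_A (C ⊗_A D)`, `(m ⊗ c) ⊗ d ↦ m ⊗ (c ⊗ d)`. -/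
def assocHom : BalTensor A (BalTensor A M C) D →+ BalTensor A M (BalTensor A C D) :=
  lift
    (lift
      (AddMonoidHom.mk' (fun m => (AddMonoidHom.compHom (mk A M (BalTensor A C D) m)).comp
        (mk A C D)) (fun m m' => by ext c d; exact add_tmul _ _ _))
      (fun a m c => by ext d; exact smul_tmul a m (tmul A c d)))
    (fun a x d => by
      induction x using induction with
      | zero => simp
      | pure m c =>
        change tmul A m (tmul A (op a • c) d) = tmul A m (tmul A c (a • d))
        rw [smul_tmul]
      | add x y hx hy => simp only [smul_add, map_add, AddMonoidHom.add_apply, hx, hy])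

@[simp]
theorem assocHom_tmul (m : M) (c : C) (d : D) :
    assocHom A M C D (tmul A (tmul A m c) d) = tmul A m (tmul A c d) := rfl

/-- The map `M ⊗_A (C ⊗_A D) → (M ⊗_A C) ⊗_A D`, `m ⊗ (c ⊗ d) ↦ (m ⊗ c) ⊗ d`. -/
def assocInv : BalTensor A M (BalTensor A C D) →+ BalTensor A (BalTensor A M C) D :=
  lift
    (AddMonoidHom.mk' (fun m => lift ((mk A (BalTensor A M C) D).comp (mk A M C m))
        (fun a c d => smul_tmul a (tmul A m c) d))
      (fun m m' => hom_ext fun c d => by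
        change tmul A (tmul A (m + m') c) d = tmul A (tmul A m c) d + tmul A (tmul A m' c) d
        rw [add_tmul, add_tmul]))
    (fun a m x => by
      induction x using induction with
      | zero => simp
      | pure c d =>
        change tmul A (tmul A (op a • m) c) d = tmul A (tmul A m (a • c)) d
        rw [smul_tmul]
      | add x y hx hy => simp only [smul_add, map_add, hx, hy])

@[simp]
theorem assocInv_tmul (m : M) (c : C) (d : D) :
    assocInv A M C D (tmul A m (tmul A c d)) = tmul A (tmul A m c) d := rfl

theorem assocInv_assocHom (x : BalTensor A (BalTensor A M C) D) :
    assocInv A M C D (assocHom A M C D x) = x := by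
  induction x using induction with
  | zero => rw [map_zero, map_zero]
  | pure x d =>
    induction x using induction with
    | zero =>
      rw [show tmul A (0 : BalTensor A M C) d = 0 from
        map_zero ((mk A (BalTensor A M C) D).flip d), map_zero, map_zero]
    | pure m c => rw [assocHom_tmul, assocInv_tmul]
    | add x y hx hy => rw [add_tmul, map_add, map_add, hx, hy]
  | add x y hx hy => rw [map_add, map_add, hx, hy]

theorem assocHom_assocInv (x : BalTensor A M (BalTensor A C D)) :
    assocHom A M C D (assocInv A M C D x) = x := by
  induction x using induction with
  | zero => rw [map_zero, map_zero]
  | pure m x =>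
    induction x using induction with
    | zero =>
      rw [show tmul A m (0 : BalTensor A C D) = 0 from
        map_zero (mk A M (BalTensor A C D) m), map_zero, map_zero]
    | pure c d => rw [assocInv_tmul, assocHom_tmul]
    | add x y hx hy => rw [tmul_add, map_add, map_add, hx, hy]
  | add x y hx hy => rw [map_add, map_add, hx, hy]

/-- The canonical isomorphism `(M ⊗_A C) ⊗_A D → M ⊗_A (C ⊗_A D)`,
`(m ⊗ c) ⊗ d ↦ m ⊗ (c ⊗ d)`. -/
def assoc : BalTensor A (BalTensor A M C) D ≃+ BalTensor A M (BalTensor A C D) where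
  toFun := assocHom A M C D
  invFun := assocInv A M C D
  left_inv := assocInv_assocHom A M C D
  right_inv := assocHom_assocInv A M C D
  map_add' := map_add _

@[simp]
theorem assoc_tmul (m : M) (c : C) (d : D) :
    assoc A M C D (tmul A (tmul A m c) d) = tmul A m (tmul A c d) := rfl

end Assoc

/-- The multiplication map `R ⊗_R M → M`, `r ⊗ m ↦ r m`. -/
def leftAct (R M : Type*) [NonUnitalRing R] [AddCommGroup M] [DistribSMul R M]
    [IsNonUnitalModule R M] : BalTensor R R M →+ M :=
  lift (AddMonoidHom.mk' (fun r => DistribSMul.toAddMonoidHom M r)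
      (fun r s => by ext m; exact IsNonUnitalModule.add_smul' r s m))
    (fun s r m => IsNonUnitalModule.mul_smul' r s m)

/-- The multiplication map `M ⊗_A A → M`, `m ⊗ a ↦ m a`. -/
def rightAct (A M : Type*) [Ring A] [AddCommGroup M] [Module Aᵐᵒᵖ M] : BalTensor A M A →+ M :=
  lift (AddMonoidHom.mk' (fun m => AddMonoidHom.mk' (fun a : A => op a • m)
        (fun a b => by rw [op_add, add_smul]))
      (fun m m' => by ext a; exact smul_add _ _ _))
    (fun s m a => by simp [mul_smul])

end BalTensor

/-- A left `R`-module is firm if the multiplication map `R ⊗_R M → M` is an isomorphism. -/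
def IsFirmModule (R M : Type*) [NonUnitalRing R] [AddCommGroup M] [DistribSMul R M]
    [IsNonUnitalModule R M] : Prop :=
  Function.Bijective (BalTensor.leftAct R M)

/-- A ring `R`, not necessarily with unit, is firm if the multiplication map `R ⊗_R R → R` is an
isomorphism. -/
def IsFirmRing (R : Type*) [NonUnitalRing R] : Prop :=
  IsFirmModule R R

/-- An `A`-coring structure on the `A`-bimodule `C`: `A`-bilinear maps `Δ : C → C ⊗_A C` and
`ε : C → A` that are coassociative and counital. -/
structure Coring (A C : Type*) [Ring A] [AddCommGroup C] [Module A C] [Module Aᵐᵒᵖ C]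
    [SMulCommClass A Aᵐᵒᵖ C] where
  comul : C →ₗ[Aᵐᵒᵖ] BalTensor A C C
  comul_smul : ∀ (a : A) (c : C), comul (a • c) = a • comul c
  counit : C →ₗ[Aᵐᵒᵖ] A
  counit_smul : ∀ (a : A) (c : C), counit (a • c) = a • counit c
  coassoc : ∀ c : C,
    BalTensor.assoc A C C C
        (BalTensor.map comul.toAddMonoidHom (fun a c => comul.map_smul (op a) c)
          (AddMonoidHom.id C) (fun _ _ => rfl) (comul c))
      = BalTensor.map (AddMonoidHom.id C) (fun _ _ => rfl) comul.toAddMonoidHom comul_smul (comul c)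
  counit_comul : ∀ c : C,
    BalTensor.leftAct A C
        (BalTensor.map counit.toAddMonoidHom (fun a c => counit.map_smul (op a) c)
          (AddMonoidHom.id C) (fun _ _ => rfl) (comul c)) = c
  comul_counit : ∀ c : C,
    BalTensor.rightAct A C
        (BalTensor.map (AddMonoidHom.id C) (fun _ _ => rfl) counit.toAddMonoidHom counit_smul
          (comul c)) = c

section Comodules

variable {A C : Type*} [Ring A] [AddCommGroup C] [Module A C] [Module Aᵐᵒᵖ C]
  [SMulCommClass A Aᵐᵒᵖ C]

/-- `f ⊗ C : M ⊗_A C → N ⊗_A C` for a right `A`-linear map `f`. -/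
def tensorRight {M N : Type*} [AddCommGroup M] [Module Aᵐᵒᵖ M] [AddCommGroup N] [Module Aᵐᵒᵖ N]
    (f : M →ₗ[Aᵐᵒᵖ] N) : BalTensor A M C →ₗ[Aᵐᵒᵖ] BalTensor A N C where
  __ := BalTensor.map f.toAddMonoidHom (fun a m => f.map_smul (op a) m) (AddMonoidHom.id C)
    (fun _ _ => rfl)
  map_smul' a x := by
    change BalTensor.map _ _ _ _ (a • x) = a • BalTensor.map _ _ _ _ x
    induction x using BalTensor.induction with
    | zero => simp only [smul_zero, map_zero]
    | pure m c => rfl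
    | add x y hx hy => simp only [smul_add, map_add, hx, hy]

@[simp]
theorem tensorRight_tmul {M N : Type*} [AddCommGroup M] [Module Aᵐᵒᵖ M] [AddCommGroup N]
    [Module Aᵐᵒᵖ N] (f : M →ₗ[Aᵐᵒᵖ] N) (m : M) (c : C) :
    tensorRight f (BalTensor.tmul A m c) = BalTensor.tmul A (f m) c := rfl

theorem tensorRight_add {M N : Type*} [AddCommGroup M] [Module Aᵐᵒᵖ M] [AddCommGroup N]
    [Module Aᵐᵒᵖ N] (f g : M →ₗ[Aᵐᵒᵖ] N) (x : BalTensor A M C) :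
    tensorRight (f + g) x = tensorRight f x + tensorRight g x := by
  induction x using BalTensor.induction with
  | zero => simp only [map_zero, add_zero]
  | pure m c => simp only [tensorRight_tmul, LinearMap.add_apply, BalTensor.add_tmul]
  | add x y hx hy => simp only [map_add, hx, hy]; abel

/-- A right `𝒞`-comodule structure on the right `A`-module `M`. -/
structure Comodule (𝒞 : Coring A C) (M : Type*) [AddCommGroup M] [Module Aᵐᵒᵖ M] where
  coact : M →ₗ[Aᵐᵒᵖ] BalTensor A M C
  coassoc : ∀ m : M,
    BalTensor.assoc A M C C (tensorRight coact (coact m))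
      = BalTensor.map (AddMonoidHom.id M) (fun _ _ => rfl) 𝒞.comul.toAddMonoidHom 𝒞.comul_smul
          (coact m)
  counit : ∀ m : M,
    BalTensor.rightAct A M
        (BalTensor.map (AddMonoidHom.id M) (fun _ _ => rfl) 𝒞.counit.toAddMonoidHom 𝒞.counit_smul
          (coact m)) = m

/-- A right `A`-linear map is right `𝒞`-colinear if `ρ_N ∘ f = (f ⊗ C) ∘ ρ_M`. -/
def IsColinear {𝒞 : Coring A C} {M N : Type*} [AddCommGroup M] [Module Aᵐᵒᵖ M] [AddCommGroup N]
    [Module Aᵐᵒᵖ N] (ρM : Comodule 𝒞 M) (ρN : Comodule 𝒞 N) (f : M →ₗ[Aᵐᵒᵖ] N) : Prop :=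
  ∀ m : M, ρN.coact (f m) = tensorRight f (ρM.coact m)

/-- Left `R`-module structure compatible with a right `𝒞`-comodule structure on the
`R`-`A`-bimodule `S`: the coaction is left `R`-linear. -/
structure Bicomodule (R : Type*) [NonUnitalRing R] (𝒞 : Coring A C) (S : Type*) [AddCommGroup S]
    [Module Aᵐᵒᵖ S] [DistribSMul R S] [IsNonUnitalModule R S] [SMulCommClass R Aᵐᵒᵖ S] extends
    Comodule 𝒞 S where
  coact_smul : ∀ (r : R) (u : S), coact (r • u) = r • coact u

/-- `Hom^𝒞(M, N)`, right `𝒞`-colinear maps, as a subgroup of the right `A`-linear maps. -/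
def Comodule.colinearMaps {𝒞 : Coring A C} {M N : Type*} [AddCommGroup M] [Module Aᵐᵒᵖ M]
    [AddCommGroup N] [Module Aᵐᵒᵖ N] (ρM : Comodule 𝒞 M) (ρN : Comodule 𝒞 N) :
    AddSubgroup (M →ₗ[Aᵐᵒᵖ] N) where
  carrier := {f | IsColinear ρM ρN f}
  zero_mem' m := by
    have h := tensorRight_add (0 : M →ₗ[Aᵐᵒᵖ] N) 0 (ρM.coact m)
    rw [add_zero, left_eq_add] at h
    rw [h, LinearMap.zero_apply, map_zero]
  add_mem' {f g} hf hg m := by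
    rw [tensorRight_add, LinearMap.add_apply, map_add, hf m, hg m]
  neg_mem' {f} hf m := by
    have h := tensorRight_add f (-f) (ρM.coact m)
    have h0 := tensorRight_add (0 : M →ₗ[Aᵐᵒᵖ] N) 0 (ρM.coact m)
    rw [add_zero, left_eq_add] at h0
    rw [add_neg_cancel, h0] at h
    rw [LinearMap.neg_apply, map_neg, hf m, neg_eq_iff_add_eq_zero, ← h]

section BimoduleActions

variable {R S M : Type*} [NonUnitalRing R] [AddCommGroup S] [Module Aᵐᵒᵖ S] [DistribSMul R S]
  [IsNonUnitalModule R S] [SMulCommClass R Aᵐᵒᵖ S] [AddCommGroup M] [Module Aᵐᵒᵖ M]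

/-- `Hom_A(S, M)`, the group of right `A`-linear maps from the `R`-`A`-bimodule `S` to `M`. -/
def HomA (A S M : Type*) [Ring A] [AddCommGroup S] [Module Aᵐᵒᵖ S] [AddCommGroup M]
    [Module Aᵐᵒᵖ M] : Type _ :=
  S →ₗ[Aᵐᵒᵖ] M

instance : AddCommGroup (HomA A S M) :=
  inferInstanceAs (AddCommGroup (S →ₗ[Aᵐᵒᵖ] M))

/-- Precomposition with the action of `r` on `S`: the map `f r : u ↦ f (r u)`. -/
def precompSMul (r : R) (f : S →ₗ[Aᵐᵒᵖ] M) : S →ₗ[Aᵐᵒᵖ] M where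
  toFun u := f (r • u)
  map_add' u v := by rw [smul_add, map_add]
  map_smul' a u := by rw [smul_comm, map_smul, RingHom.id_apply]

theorem tensorRight_precompSMul (r : R) (f : S →ₗ[Aᵐᵒᵖ] M) (x : BalTensor A S C) :
    tensorRight (precompSMul r f) x = tensorRight f (r • x) := by
  induction x using BalTensor.induction with
  | zero => simp only [smul_zero, map_zero]
  | pure m c => rfl
  | add x y hx hy => simp only [smul_add, map_add, hx, hy]

/-- The right `R`-action `(f r)(u) = f (r u)` on `Hom_A(S, M)`. -/
instance HomA.instSMul : SMul Rᵐᵒᵖ (HomA A S M) where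
  smul r f := precompSMul (unop r) f

/-- `Hom^𝒞(S, N)`, the group of right `𝒞`-colinear maps from the bicomodule `S` to `N`. -/
def HomC {𝒞 : Coring A C} (σ : Bicomodule R 𝒞 S) (ρ : Comodule 𝒞 M) : Type _ :=
  σ.toComodule.colinearMaps ρ

instance {𝒞 : Coring A C} (σ : Bicomodule R 𝒞 S) (ρ : Comodule 𝒞 M) : AddCommGroup (HomC σ ρ) :=
  inferInstanceAs (AddCommGroup (σ.toComodule.colinearMaps ρ))

/-- The right `R`-action `(f r)(u) = f (r u)` on `Hom^𝒞(S, N)`. -/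
instance HomC.instSMul {𝒞 : Coring A C} (σ : Bicomodule R 𝒞 S) (ρ : Comodule 𝒞 M) :
    SMul Rᵐᵒᵖ (HomC σ ρ) where
  smul r f := ⟨precompSMul (unop r) f.1, fun u => by
    rw [tensorRight_precompSMul, ← σ.coact_smul]
    exact f.2 (unop r • u)⟩

/-- The canonical map `can_M : Hom_A(S, M) ⊗_R S → M ⊗_A C`, `f ⊗ u ↦ f(u_[0]) ⊗ u_[1]`, as a map
of right `A`-modules. -/
def can {𝒞 : Coring A C} (σ : Bicomodule R 𝒞 S) (M : Type*) [AddCommGroup M] [Module Aᵐᵒᵖ M] :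
    BalTensor R (HomA A S M) S →ₗ[Aᵐᵒᵖ] BalTensor A M C where
  __ := BalTensor.lift
    (AddMonoidHom.mk' (fun f : HomA A S M =>
        ((tensorRight (f : S →ₗ[Aᵐᵒᵖ] M)).comp σ.coact).toAddMonoidHom)
      (fun f g => by ext u; exact tensorRight_add f g (σ.coact u)))
    (fun r f u => by
      exact (tensorRight_precompSMul r f (σ.coact u)).trans
        (congrArg (tensorRight (f : S →ₗ[Aᵐᵒᵖ] M)) (σ.coact_smul r u).symm))
  map_smul' a x := by
    change BalTensor.lift _ _ (a • x) = a • BalTensor.lift _ _ x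
    induction x using BalTensor.induction with
    | zero => simp only [smul_zero, map_zero]
    | pure f u =>
      change tensorRight f (σ.coact (a • u)) = a • tensorRight f (σ.coact u)
      rw [map_smul, map_smul]
    | add x y hx hy => simp only [smul_add, map_add, hx, hy]

/-- The evaluation map `ev_N : Hom^𝒞(S, N) ⊗_R S → N`, `f ⊗ u ↦ f(u)`, as a map of right
`A`-modules. -/
def ev {𝒞 : Coring A C} (σ : Bicomodule R 𝒞 S) (ρ : Comodule 𝒞 M) :
    BalTensor R (HomC σ ρ) S →ₗ[Aᵐᵒᵖ] M where
  __ := BalTensor.lift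
    (AddMonoidHom.mk' (fun f : HomC σ ρ => f.1.toAddMonoidHom) (fun f g => rfl))
    (fun r f u => rfl)
  map_smul' a x := by
    change BalTensor.lift _ _ (a • x) = a • BalTensor.lift _ _ x
    induction x using BalTensor.induction with
    | zero => simp only [smul_zero, map_zero]
    | pure f u => exact f.1.map_smul a u
    | add x y hx hy => simp only [smul_add, map_add, hx, hy]

@[simp]
theorem can_tmul {𝒞 : Coring A C} (σ : Bicomodule R 𝒞 S) (f : HomA A S M) (u : S) :
    can σ M (BalTensor.tmul R f u) = tensorRight (f : S →ₗ[Aᵐᵒᵖ] M) (σ.coact u) := rfl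

@[simp]
theorem ev_tmul {𝒞 : Coring A C} (σ : Bicomodule R 𝒞 S) (ρ : Comodule 𝒞 M) (f : HomC σ ρ) (u : S) :
    ev σ ρ (BalTensor.tmul R f u) = f.1 u := rfl

end BimoduleActions

end Comodules

section Galois

/-- The comodule `N` is `(𝒞, A)`-injective: for every colinear `i : K → L` that is a split
monomorphism of right `A`-modules, every colinear `f : K → N` extends along `i` to a colinear
`g : L → N`. -/
def IsRelInjective {A C : Type u} [Ring A] [AddCommGroup C] [Module A C] [Module Aᵐᵒᵖ C]
    [SMulCommClass A Aᵐᵒᵖ C] {𝒞 : Coring A C} {N : Type u} [AddCommGroup N] [Module Aᵐᵒᵖ N]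
    (ρN : Comodule 𝒞 N) : Prop :=
  ∀ (K L : Type u) [AddCommGroup K] [Module Aᵐᵒᵖ K] [AddCommGroup L] [Module Aᵐᵒᵖ L]
    (ρK : Comodule 𝒞 K) (ρL : Comodule 𝒞 L) (i : K →ₗ[Aᵐᵒᵖ] L), IsColinear ρK ρL i →
    (∃ p : L →ₗ[Aᵐᵒᵖ] K, ∀ k, p (i k) = k) →
    ∀ f : K →ₗ[Aᵐᵒᵖ] N, IsColinear ρK ρN f →
      ∃ g : L →ₗ[Aᵐᵒᵖ] N, IsColinear ρL ρN g ∧ ∀ k, g (i k) = f k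

/-- `S` is an `R`-`𝒞` comonadic-Galois comodule: `can_M` is an isomorphism for all right
`A`-modules `M`. -/
def IsComonadicGalois {A R C S : Type u} [Ring A] [NonUnitalRing R] [AddCommGroup C] [Module A C]
    [Module Aᵐᵒᵖ C] [SMulCommClass A Aᵐᵒᵖ C] [AddCommGroup S] [Module Aᵐᵒᵖ S] [DistribSMul R S]
    [IsNonUnitalModule R S] [SMulCommClass R Aᵐᵒᵖ S] {𝒞 : Coring A C} (σ : Bicomodule R 𝒞 S) :
    Prop :=
  ∀ (M : Type u) [AddCommGroup M] [Module Aᵐᵒᵖ M], Function.Bijective (can σ M)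

end Galois

/-! Right `𝒞`-comodules are the coalgebras of the comonad `- ⊗_A C` on right `A`-modules, with
comultiplication `M ⊗ Δ` and counit `M ⊗ ε`; the comonad laws follow from the coring axioms because
each map `ι_m : C → M ⊗_A C`, `c ↦ m ⊗ c`, satisfies `(M ⊗ Δ) ∘ ι_m = (ι_m ⊗ C) ∘ Δ`. The comodule
`M ⊗_A C` is therefore cofree on `M`: `Hom_A(S, M) ≃ Hom^𝒞(S, M ⊗_A C)`, and under this bijection
`can_M` becomes `ev_{M ⊗ C}`. A comodule `N` is `(𝒞, A)`-injective exactly when its coaction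
`N → N ⊗_A C` has a colinear retraction, so it is a retract of a cofree comodule; as `ev` is
natural, its bijectivity passes to retracts. -/

theorem bijective_of_retract {X Y X' Y' : Type*} {f : X → Y} {g : X' → Y'} {i : X → X'}
    {r : X' → X} {j : Y → Y'} {s : Y' → Y} (hri : Function.LeftInverse r i)
    (hsj : Function.LeftInverse s j) (hgi : g ∘ i = j ∘ f) (hfr : f ∘ r = s ∘ g)
    (hg : Function.Bijective g) : Function.Bijective f where
  left := .of_comp (f := j) (hgi ▸ hg.injective.comp hri.injective)
  right := .of_comp (g := r) (hfr ▸ hsj.surjective.comp hg.surjective)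

namespace BalTensor

section RTensor

variable {S M M' : Type*} (N : Type*) [AddCommGroup M] [AddCommGroup M'] [AddCommGroup N]
  [SMul Sᵐᵒᵖ M] [SMul Sᵐᵒᵖ M'] [SMul S N]

/-- `f ⊗ N : M ⊗_S N → M' ⊗_S N` for a right `S`-linear `f`. In contrast to `tensorRight`, the
ring `S` need not have a unit. -/
def rTensor (f : M →+ M') (hf : ∀ (s : S) m, f (op s • m) = op s • f m) :
    BalTensor S M N →+ BalTensor S M' N :=
  map f hf (AddMonoidHom.id N) fun _ _ => rfl

theorem rTensor_leftInverse {f : M →+ M'} {g : M' →+ M}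
    (hf : ∀ (s : S) m, f (op s • m) = op s • f m) (hg : ∀ (s : S) m, g (op s • m) = op s • g m)
    (hgf : Function.LeftInverse g f) :
    Function.LeftInverse (rTensor N g hg) (rTensor N f hf) :=
  DFunLike.congr_fun (f := (rTensor N g hg).comp (rTensor N f hf)) (g := AddMonoidHom.id _) <|
    hom_ext fun m n => congrArg (tmul S · n) (hgf m)

/-- `e ⊗ N : M ⊗_S N ≃ M' ⊗_S N` for a right `S`-linear isomorphism `e`. -/
def congrLeft (e : M ≃+ M') (he : ∀ (s : S) m, e (op s • m) = op s • e m) :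
    BalTensor S M N ≃+ BalTensor S M' N :=
  have he' (s : S) (m : M') : e.symm (op s • m) = op s • e.symm m := by
    rw [e.symm_apply_eq, he, e.apply_symm_apply]
  { rTensor N e.toAddMonoidHom he with
    invFun := rTensor N e.symm.toAddMonoidHom he'
    left_inv := rTensor_leftInverse N he he' e.symm_apply_apply
    right_inv := rTensor_leftInverse N he' he e.apply_symm_apply }

end RTensor

section RightLinear

variable {S T M N P : Type*} [Ring T] [AddCommGroup M] [AddCommGroup N] [AddCommGroup P]
  [SMul Sᵐᵒᵖ M] [SMul S N] [Module Tᵐᵒᵖ N] [SMulCommClass S Tᵐᵒᵖ N] [Module Tᵐᵒᵖ P]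

theorem linearMap_ext {f g : BalTensor S M N →ₗ[Tᵐᵒᵖ] P}
    (h : ∀ m n, f (tmul S m n) = g (tmul S m n)) : f = g :=
  LinearMap.toAddMonoidHom_injective (hom_ext h)

/-- An additive map on `M ⊗_S N` that is right `T`-linear on pure tensors, as a right `T`-linear
map. -/
def toLinearMap (f : BalTensor S M N →+ P)
    (hf : ∀ (t : Tᵐᵒᵖ) m n, f (tmul S m (t • n)) = t • f (tmul S m n)) :
    BalTensor S M N →ₗ[Tᵐᵒᵖ] P where
  __ := f
  map_smul' t := DFunLike.congr_fun <|
    hom_ext (f := f.comp (DistribSMul.toAddMonoidHom _ t))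
      (g := (DistribSMul.toAddMonoidHom P t).comp f) (hf t)

variable (S T N) in
/-- The right `T`-linear map `N → M ⊗_S N`, `n ↦ m ⊗ n`. -/
def tmulHom (m : M) : N →ₗ[Tᵐᵒᵖ] BalTensor S M N where
  __ := mk S M N m
  map_smul' _ _ := rfl

end RightLinear

end BalTensor

section Cofree

open BalTensor

variable {A C : Type*} [Ring A] [AddCommGroup C] [Module A C] [Module Aᵐᵒᵖ C]
  [SMulCommClass A Aᵐᵒᵖ C]

variable {K L M N : Type*} [AddCommGroup K] [Module Aᵐᵒᵖ K] [AddCommGroup L] [Module Aᵐᵒᵖ L]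
  [AddCommGroup M] [Module Aᵐᵒᵖ M] [AddCommGroup N] [Module Aᵐᵒᵖ N]

theorem tensorRight_id : tensorRight (C := C) (LinearMap.id : M →ₗ[Aᵐᵒᵖ] M) = LinearMap.id :=
  linearMap_ext fun _ _ => rfl

theorem tensorRight_comp (g : L →ₗ[Aᵐᵒᵖ] M) (f : K →ₗ[Aᵐᵒᵖ] L) :
    tensorRight (C := C) (g ∘ₗ f) = tensorRight g ∘ₗ tensorRight f :=
  linearMap_ext fun _ _ => rfl

theorem tensorRight_tmulHom (m : M) (x : BalTensor A C C) :
    tensorRight (tmulHom A A C m) x = (assoc A M C C).symm (tmul A m x) := rfl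

namespace Coring

variable (𝒞 : Coring A C)

/-- The right regular comodule: `C` with coaction `Δ`. -/
def regular : Comodule 𝒞 C where
  coact := 𝒞.comul
  coassoc := 𝒞.coassoc
  counit := 𝒞.comul_counit

variable (M) in
/-- `M ⊗ ε : M ⊗_A C → M`, `m ⊗ c ↦ m ε(c)`, the counit of the comonad `- ⊗_A C`. -/
def counitRight : BalTensor A M C →ₗ[Aᵐᵒᵖ] M :=
  toLinearMap ((rightAct A M).comp
    (BalTensor.map (AddMonoidHom.id M) (fun _ _ => rfl) 𝒞.counit.toAddMonoidHom 𝒞.counit_smul))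
    fun a m c => by
      change op (𝒞.counit (a • c)) • m = a • op (𝒞.counit c) • m
      rw [map_smul, ← mul_smul]
      rfl

variable (M) in
/-- `M ⊗ Δ : M ⊗_A C → (M ⊗_A C) ⊗_A C`, the comultiplication of the comonad `- ⊗_A C`. -/
def comulRight : BalTensor A M C →ₗ[Aᵐᵒᵖ] BalTensor A (BalTensor A M C) C :=
  toLinearMap ((assoc A M C C).symm.toAddMonoidHom.comp
    (BalTensor.map (AddMonoidHom.id M) (fun _ _ => rfl) 𝒞.comul.toAddMonoidHom 𝒞.comul_smul))
    fun a m c => by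
      change (assoc A M C C).symm (tmul A m (𝒞.comul (a • c))) =
        a • (assoc A M C C).symm (tmul A m (𝒞.comul c))
      rw [← tensorRight_tmulHom, ← tensorRight_tmulHom, map_smul, map_smul]

theorem comulRight_tmul (m : M) (c : C) :
    𝒞.comulRight M (tmul A m c) = tensorRight (tmulHom A A C m) (𝒞.comul c) := rfl

theorem counitRight_comp_tensorRight (f : M →ₗ[Aᵐᵒᵖ] N) :
    𝒞.counitRight N ∘ₗ tensorRight f = f ∘ₗ 𝒞.counitRight M :=
  linearMap_ext fun m c => (f.map_smul (op (𝒞.counit c)) m).symm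

theorem comulRight_comp_tensorRight (f : M →ₗ[Aᵐᵒᵖ] N) :
    𝒞.comulRight N ∘ₗ tensorRight f = tensorRight (tensorRight f) ∘ₗ 𝒞.comulRight M :=
  linearMap_ext fun m c =>
    calc 𝒞.comulRight N (tmul A (f m) c)
        = tensorRight (tensorRight f ∘ₗ tmulHom A A C m) (𝒞.comul c) := 𝒞.comulRight_tmul (f m) c
      _ = tensorRight (tensorRight f) (tensorRight (tmulHom A A C m) (𝒞.comul c)) :=
          LinearMap.congr_fun (tensorRight_comp (tensorRight f) (tmulHom A A C m)) _
      _ = tensorRight (tensorRight f) (𝒞.comulRight M (tmul A m c)) :=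
          congrArg _ (𝒞.comulRight_tmul m c).symm

end Coring

namespace Comodule

variable {𝒞 : Coring A C} (ρ : Comodule 𝒞 M)

theorem counitRight_coact (m : M) : 𝒞.counitRight M (ρ.coact m) = m :=
  ρ.counit m

theorem comulRight_coact (m : M) :
    𝒞.comulRight M (ρ.coact m) = tensorRight ρ.coact (ρ.coact m) :=
  (AddEquiv.symm_apply_eq _).2 (ρ.coassoc m).symm

end Comodule

namespace Coring

variable (𝒞 : Coring A C)

theorem comulRight_comp_comulRight :
    𝒞.comulRight (BalTensor A M C) ∘ₗ 𝒞.comulRight M =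
      tensorRight (𝒞.comulRight M) ∘ₗ 𝒞.comulRight M :=
  linearMap_ext fun m c => by
    let ι := tmulHom A A C m
    calc 𝒞.comulRight (BalTensor A M C) (𝒞.comulRight M (tmul A m c))
        = 𝒞.comulRight (BalTensor A M C) (tensorRight ι (𝒞.comul c)) :=
          congrArg _ (𝒞.comulRight_tmul m c)
      _ = tensorRight (tensorRight ι) (𝒞.comulRight C (𝒞.comul c)) :=
          LinearMap.congr_fun (𝒞.comulRight_comp_tensorRight ι) _
      _ = tensorRight (tensorRight ι) (tensorRight 𝒞.comul (𝒞.comul c)) :=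
          congrArg _ (𝒞.regular.comulRight_coact c)
      _ = tensorRight (𝒞.comulRight M ∘ₗ ι) (𝒞.comul c) :=
          (LinearMap.congr_fun (tensorRight_comp (tensorRight ι) 𝒞.comul) _).symm
      _ = tensorRight (𝒞.comulRight M) (tensorRight ι (𝒞.comul c)) :=
          LinearMap.congr_fun (tensorRight_comp (𝒞.comulRight M) ι) _
      _ = tensorRight (𝒞.comulRight M) (𝒞.comulRight M (tmul A m c)) :=
          congrArg _ (𝒞.comulRight_tmul m c).symm

theorem counitRight_comp_comulRight :
    𝒞.counitRight (BalTensor A M C) ∘ₗ 𝒞.comulRight M = LinearMap.id :=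
  linearMap_ext fun m c => by
    let ι := tmulHom A A C m
    calc 𝒞.counitRight (BalTensor A M C) (𝒞.comulRight M (tmul A m c))
        = 𝒞.counitRight (BalTensor A M C) (tensorRight ι (𝒞.comul c)) :=
          congrArg _ (𝒞.comulRight_tmul m c)
      _ = ι (𝒞.counitRight C (𝒞.comul c)) :=
          LinearMap.congr_fun (𝒞.counitRight_comp_tensorRight ι) _
      _ = ι c := congrArg ι (𝒞.comul_counit c)

theorem tensorRight_counitRight_comp_tmulHom (m : M) :
    (tensorRight (𝒞.counitRight M ∘ₗ tmulHom A A C m)).toAddMonoidHom =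
      (BalTensor.mk A M C m).comp ((leftAct A C).comp
        (rTensor C 𝒞.counit.toAddMonoidHom fun a c => 𝒞.counit.map_smul (op a) c)) :=
  hom_ext fun b c => smul_tmul (𝒞.counit b) m c

theorem tensorRight_counitRight_comp_comulRight :
    tensorRight (𝒞.counitRight M) ∘ₗ 𝒞.comulRight M = LinearMap.id :=
  linearMap_ext fun m c => by
    let ι := tmulHom A A C m
    calc tensorRight (𝒞.counitRight M) (𝒞.comulRight M (tmul A m c))
        = tensorRight (𝒞.counitRight M) (tensorRight ι (𝒞.comul c)) :=
          congrArg _ (𝒞.comulRight_tmul m c)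
      _ = tensorRight (𝒞.counitRight M ∘ₗ ι) (𝒞.comul c) :=
          (LinearMap.congr_fun (tensorRight_comp (𝒞.counitRight M) ι) _).symm
      _ = tmul A m (leftAct A C (rTensor C 𝒞.counit.toAddMonoidHom _ (𝒞.comul c))) :=
          DFunLike.congr_fun (𝒞.tensorRight_counitRight_comp_tmulHom m) _
      _ = tmul A m c := congrArg (tmul A m) (𝒞.counit_comul c)

variable (M) in
/-- The cofree comodule `M ⊗_A C` on the right `A`-module `M`, with coaction `M ⊗ Δ`. -/
def cofree : Comodule 𝒞 (BalTensor A M C) where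
  coact := 𝒞.comulRight M
  coassoc x := ((AddEquiv.symm_apply_eq _).1
    (LinearMap.congr_fun 𝒞.comulRight_comp_comulRight x)).symm
  counit := LinearMap.congr_fun 𝒞.counitRight_comp_comulRight

theorem isColinear_tensorRight (f : M →ₗ[Aᵐᵒᵖ] N) :
    IsColinear (𝒞.cofree M) (𝒞.cofree N) (tensorRight f) :=
  LinearMap.congr_fun (𝒞.comulRight_comp_tensorRight f)

end Coring

theorem IsColinear.id {𝒞 : Coring A C} (ρ : Comodule 𝒞 M) : IsColinear ρ ρ LinearMap.id :=
  fun m => by rw [tensorRight_id, LinearMap.id_apply, LinearMap.id_apply]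

section Adjunction

variable {𝒞 : Coring A C}

theorem IsColinear.comp {ρK : Comodule 𝒞 K} {ρL : Comodule 𝒞 L} {ρM : Comodule 𝒞 M}
    {g : L →ₗ[Aᵐᵒᵖ] M} {f : K →ₗ[Aᵐᵒᵖ] L} (hg : IsColinear ρL ρM g) (hf : IsColinear ρK ρL f) :
    IsColinear ρK ρM (g ∘ₗ f) := fun k => by
  rw [tensorRight_comp, LinearMap.comp_apply, LinearMap.comp_apply, hg, hf]

namespace Comodule

variable (ρ : Comodule 𝒞 K)

theorem isColinear_coact : IsColinear ρ (𝒞.cofree K) ρ.coact :=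
  ρ.comulRight_coact

/-- The coextension `(f ⊗ C) ∘ ρ : K → M ⊗_A C` of a right `A`-linear `f : K → M`, the colinear map
that the universal property of the cofree comodule assigns to `f`. -/
def coextend (f : K →ₗ[Aᵐᵒᵖ] M) : K →ₗ[Aᵐᵒᵖ] BalTensor A M C :=
  tensorRight f ∘ₗ ρ.coact

theorem isColinear_coextend (f : K →ₗ[Aᵐᵒᵖ] M) : IsColinear ρ (𝒞.cofree M) (ρ.coextend f) :=
  (𝒞.isColinear_tensorRight f).comp ρ.isColinear_coact

theorem counitRight_coextend (f : K →ₗ[Aᵐᵒᵖ] M) :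
    𝒞.counitRight M ∘ₗ ρ.coextend f = f := by
  ext k
  calc 𝒞.counitRight M (tensorRight f (ρ.coact k))
      = f (𝒞.counitRight K (ρ.coact k)) :=
        LinearMap.congr_fun (𝒞.counitRight_comp_tensorRight f) _
    _ = f k := congrArg f (ρ.counitRight_coact k)

theorem coextend_counitRight {g : K →ₗ[Aᵐᵒᵖ] BalTensor A M C}
    (hg : IsColinear ρ (𝒞.cofree M) g) :
    ρ.coextend (𝒞.counitRight M ∘ₗ g) = g := by
  ext k
  calc tensorRight (𝒞.counitRight M ∘ₗ g) (ρ.coact k)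
      = tensorRight (𝒞.counitRight M) (tensorRight g (ρ.coact k)) := by
        rw [tensorRight_comp, LinearMap.comp_apply]
    _ = tensorRight (𝒞.counitRight M) (𝒞.comulRight M (g k)) := congrArg _ (hg k).symm
    _ = g k := LinearMap.congr_fun 𝒞.tensorRight_counitRight_comp_comulRight (g k)

variable (M) in
/-- The adjunction between the forgetful functor and the cofree comodule functor:
`Hom_A(K, M) ≃ Hom^𝒞(K, M ⊗_A C)`, `f ↦ (f ⊗ C) ∘ ρ`. -/
def coextendEquiv : (K →ₗ[Aᵐᵒᵖ] M) ≃+ ρ.colinearMaps (𝒞.cofree M) where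
  toFun f := ⟨ρ.coextend f, ρ.isColinear_coextend f⟩
  invFun g := 𝒞.counitRight M ∘ₗ g.1
  left_inv := ρ.counitRight_coextend
  right_inv g := Subtype.ext (ρ.coextend_counitRight g.2)
  map_add' f g := Subtype.ext (LinearMap.ext fun k => tensorRight_add f g (ρ.coact k))

end Comodule

end Adjunction

section Evaluation

variable {R S : Type*} [NonUnitalRing R] [AddCommGroup S] [Module Aᵐᵒᵖ S] [DistribSMul R S]
  [IsNonUnitalModule R S] [SMulCommClass R Aᵐᵒᵖ S] {𝒞 : Coring A C} (σ : Bicomodule R 𝒞 S)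

namespace Bicomodule

variable (M) in
/-- The adjunction isomorphism `Hom_A(S, M) ≃ Hom^𝒞(S, M ⊗_A C)` between the domains of `can_M` and
`ev_{M ⊗ C}`. -/
def homEquiv : HomA A S M ≃+ HomC σ (𝒞.cofree M) :=
  σ.coextendEquiv M

theorem homEquiv_smul (r : R) (f : HomA A S M) :
    σ.homEquiv M (op r • f) = op r • σ.homEquiv M f :=
  Subtype.ext <| LinearMap.ext fun u =>
    (tensorRight_precompSMul r f (σ.coact u)).trans
      (congrArg (tensorRight (f : S →ₗ[Aᵐᵒᵖ] M)) (σ.coact_smul r u).symm)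

variable (M) in
theorem ev_comp_congrLeft_homEquiv :
    ev σ (𝒞.cofree M) ∘ congrLeft S (σ.homEquiv M) σ.homEquiv_smul = can σ M :=
  congrArg DFunLike.coe <| hom_ext
    (f := (ev σ (𝒞.cofree M)).toAddMonoidHom.comp
      (congrLeft S (σ.homEquiv M) σ.homEquiv_smul).toAddMonoidHom)
    (g := (can σ M).toAddMonoidHom) fun _ _ => rfl

variable (M) in
theorem can_bijective_iff :
    Function.Bijective (can σ M) ↔ Function.Bijective (ev σ (𝒞.cofree M)) := by
  rw [← σ.ev_comp_congrLeft_homEquiv M, Function.Bijective.of_comp_iff _ (AddEquiv.bijective _)]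

variable {ρM : Comodule 𝒞 M} {ρN : Comodule 𝒞 N}

/-- `Hom^𝒞(S, g) : Hom^𝒞(S, M) → Hom^𝒞(S, N)`, composition with a colinear `g : M → N`. -/
def postcomp {g : M →ₗ[Aᵐᵒᵖ] N} (hg : IsColinear ρM ρN g) : HomC σ ρM →+ HomC σ ρN :=
  AddMonoidHom.mk' (fun f => ⟨g ∘ₗ f.1, hg.comp f.2⟩)
    fun f f' => Subtype.ext (LinearMap.comp_add f.1 f'.1 g)

theorem ev_comp_rTensor_postcomp {g : M →ₗ[Aᵐᵒᵖ] N} (hg : IsColinear ρM ρN g) :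
    ev σ ρN ∘ rTensor S (σ.postcomp hg) (fun (_ : R) _ => rfl) = g ∘ ev σ ρM :=
  congrArg DFunLike.coe <| hom_ext
    (f := (ev σ ρN).toAddMonoidHom.comp (rTensor S (σ.postcomp hg) fun (_ : R) _ => rfl))
    (g := g.toAddMonoidHom.comp (ev σ ρM).toAddMonoidHom) fun _ _ => rfl

theorem ev_bijective_of_retract {i : M →ₗ[Aᵐᵒᵖ] N} {p : N →ₗ[Aᵐᵒᵖ] M}
    (hi : IsColinear ρM ρN i) (hp : IsColinear ρN ρM p) (hpi : Function.LeftInverse p i)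
    (hN : Function.Bijective (ev σ ρN)) : Function.Bijective (ev σ ρM) :=
  have hpi' : Function.LeftInverse (σ.postcomp hp) (σ.postcomp hi) := fun f =>
    Subtype.ext (LinearMap.ext fun u => hpi (f.1 u))
  bijective_of_retract (rTensor_leftInverse S _ _ hpi') hpi
    (σ.ev_comp_rTensor_postcomp hi) (σ.ev_comp_rTensor_postcomp hp) hN

end Bicomodule

end Evaluation

end Cofree

section RelInjective

variable {A C : Type u} [Ring A] [AddCommGroup C] [Module A C] [Module Aᵐᵒᵖ C]
  [SMulCommClass A Aᵐᵒᵖ C] {𝒞 : Coring A C}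

theorem isRelInjective_iff_exists_retraction {N : Type u} [AddCommGroup N] [Module Aᵐᵒᵖ N]
    {ρ : Comodule 𝒞 N} :
    IsRelInjective ρ ↔ ∃ p : BalTensor A N C →ₗ[Aᵐᵒᵖ] N,
      IsColinear (𝒞.cofree N) ρ p ∧ Function.LeftInverse p ρ.coact := by
  constructor
  · intro h
    exact h N (BalTensor A N C) ρ (𝒞.cofree N) ρ.coact ρ.isColinear_coact
      ⟨𝒞.counitRight N, ρ.counitRight_coact⟩ LinearMap.id (IsColinear.id ρ)
  · rintro ⟨p, hp, hpρ⟩ K L _ _ _ _ ρK ρL i hi ⟨q, hq⟩ f hf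
    have hfqi : (f ∘ₗ q) ∘ₗ i = f := LinearMap.ext fun k => congrArg f (hq k)
    refine ⟨p ∘ₗ ρL.coextend (f ∘ₗ q), hp.comp (ρL.isColinear_coextend _), fun k => ?_⟩
    calc p (tensorRight (f ∘ₗ q) (ρL.coact (i k)))
        = p (tensorRight ((f ∘ₗ q) ∘ₗ i) (ρK.coact k)) := by
          rw [hi, tensorRight_comp (f ∘ₗ q) i, LinearMap.comp_apply]
      _ = p (ρ.coact (f k)) := by rw [hfqi, hf]
      _ = f k := hpρ (f k)

theorem Coring.isRelInjective_cofree (𝒞 : Coring A C) (M : Type u) [AddCommGroup M]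
    [Module Aᵐᵒᵖ M] : IsRelInjective (𝒞.cofree M) :=
  isRelInjective_iff_exists_retraction.2 ⟨tensorRight (𝒞.counitRight M),
    𝒞.isColinear_tensorRight _, LinearMap.congr_fun 𝒞.tensorRight_counitRight_comp_comulRight⟩

end RelInjective

theorem theorem3p3_general {A R C S : Type u} [Ring A] [NonUnitalRing R]
    [AddCommGroup C] [Module A C] [Module Aᵐᵒᵖ C] [SMulCommClass A Aᵐᵒᵖ C]
    [AddCommGroup S] [Module Aᵐᵒᵖ S] [DistribSMul R S] [IsNonUnitalModule R S]
    [SMulCommClass R Aᵐᵒᵖ S] (𝒞 : Coring A C) (σ : Bicomodule R 𝒞 S) :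
    IsComonadicGalois σ ↔
      ∀ (N : Type u) [AddCommGroup N] [Module Aᵐᵒᵖ N] (ρ : Comodule 𝒞 N),
        IsRelInjective ρ → Function.Bijective (ev σ ρ) := by
  constructor
  · intro hσ N _ _ ρ hρ
    obtain ⟨p, hp, hpρ⟩ := isRelInjective_iff_exists_retraction.1 hρ
    have hcofree : Function.Bijective (ev σ (𝒞.cofree N)) := (σ.can_bijective_iff N).1 (hσ N)
    exact σ.ev_bijective_of_retract ρ.isColinear_coact hp hpρ hcofree
  · intro hev M _ _
    exact (σ.can_bijective_iff M).2 (hev _ _ (𝒞.isRelInjective_cofree M))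

theorem theorem3p3 {A R C S : Type u} [Ring A] [NonUnitalRing R]
    [AddCommGroup C] [Module A C] [Module Aᵐᵒᵖ C] [SMulCommClass A Aᵐᵒᵖ C]
    [AddCommGroup S] [Module Aᵐᵒᵖ S] [DistribSMul R S] [IsNonUnitalModule R S]
    [SMulCommClass R Aᵐᵒᵖ S]
    (hR : IsFirmRing R) (hS : IsFirmModule R S)
    (𝒞 : Coring A C) (σ : Bicomodule R 𝒞 S) :
    IsComonadicGalois σ ↔
      ∀ (N : Type u) [AddCommGroup N] [Module Aᵐᵒᵖ N] (ρ : Comodule 𝒞 N),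
        IsRelInjective ρ → Function.Bijective (ev σ ρ) :=
  theorem3p3_general 𝒞 σ
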